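/- Let $[n]=\{1,\dots,n\}$ and let $[n]^{(3)}$ denote the set of all $3$-element subsets of $[n]$, also viewed as the complete $3$-graph on $[n]$. A $3$-graph $G$ on $[n]$ is given by an edge set $E(G)\subseteq [n]^{(3)}$, and its Lagrangian is $$\lambda(G)=\max\Big\{\sum_{\{a,b,c\}\in E(G)}x_ax_bx_c \;:\; x_1,\dots,x_n\ge 0,\ \sum_{v=1}^n x_v=1\Big\}.$$ $G$ is left-compressed if, whenever $\{b_1<b_2<b_3\}\in E(G)$ and $1\le a_1<a_2<a_3$ are integers with $a_p\le b_p$ for $p=1,2,3$, also $\{a_1,a_2,a_3\}\in E(G)$. In the colex ordering, $A<B$ for distinct finite sets $A,B$ of positive integers if $\max(A\,\triangle\, B)\in B$. Let $i\ge j\ge 1$ and $l$ be positive integers, and let $G$ be a left-compressed $3$-graph on $[l]$ with exactly $\binom{l-1}{3}+\binom{l-2}{2}$ edges. Suppose that the first $j+1$ triples, in the colex ordering, of the complement $G^c=[l]^{(3)}\setminus E(G)$ are the $j$ triples $\{a,\,l-2,\,l-1\}$ with $l-2-j\le a\le l-3$, followed by the triple $\{l-2-i,\,l-2,\,l\}$.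 Then $$\lambda(G)<\lambda\big([l-1]^{(3)}\big).$$ -/

import Mathlib

/-- An `r`-uniform hypergraph (an `r`-graph) on the vertex set `[n] = {1, …, n}`. -/
structure RGraph (r n : ℕ) where
  /-- The set of edges. -/
  edges : Finset (Finset ℕ)
  edges_subset : edges ⊆ (Finset.Icc 1 n).powersetCard r

namespace RGraph

/-- The complete `r`-graph `[n]^(r)`, whose edges are all `r`-subsets of `{1, …, n}`. -/
def complete (r n : ℕ) : RGraph r n where
  edges := (Finset.Icc 1 n).powersetCard r
  edges_subset := Finset.Subset.refl _

/-- The complement `Gᶜ = [n]^(r) \ E(G)`. -/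
def compl {r n : ℕ} (G : RGraph r n) : RGraph r n where
  edges := (Finset.Icc 1 n).powersetCard r \ G.edges
  edges_subset := Finset.sdiff_subset

/-- `G` is left-compressed: if `b₁ < ⋯ < b_r` form an edge and `a₁ < ⋯ < a_r` are vertices with
`a_p ≤ b_p` for every `p`, then `a₁, …, a_r` form an edge. -/
def LeftCompressed {r n : ℕ} (G : RGraph r n) : Prop :=
  ∀ a b : Fin r → ℕ, StrictMono a → StrictMono b → (∀ p, 1 ≤ a p) → (∀ p, a p ≤ b p) →
    Finset.univ.image b ∈ G.edges → Finset.univ.image a ∈ G.edges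

/-- The set `S` of legal weightings: nonnegative weights on `{1, …, n}` with sum `1`. A vector
indexed by `{1, …, n}` is represented by its extension by zero to `ℕ`. -/
def weightings (n : ℕ) : Set (ℕ → ℝ) :=
  {x | (∀ v, 0 ≤ x v) ∧ (∀ v, v ∉ Finset.Icc 1 n → x v = 0) ∧ ∑ v ∈ Finset.Icc 1 n, x v = 1}

/-- `λ(G, x)`, the sum over the edges of the product of the weights of their vertices. -/
def weight {r n : ℕ} (G : RGraph r n) (x : ℕ → ℝ) : ℝ :=
  ∑ e ∈ G.edges, ∏ v ∈ e, x v

/-- The Lagrangian `λ(G)`, the maximum of `λ(G, x)` over all legal weightings `x`; that the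
supremum is a maximum is `isGreatest_lagrangian`. -/
noncomputable def lagrangian {r n : ℕ} (G : RGraph r n) : ℝ :=
  sSup (G.weight '' weightings n)

theorem isCompact_weightings (n : ℕ) : IsCompact (weightings n) := by
  refine IsCompact.of_isClosed_subset
    (isCompact_univ_pi (s := fun _ : ℕ => Set.Icc (0 : ℝ) 1) fun _ => isCompact_Icc) ?_ ?_
  · simp only [weightings, Set.ofPred_and, Set.ofPred_forall]
    refine (isClosed_iInter fun v => isClosed_le continuous_const (continuous_apply v)).inter
      ((isClosed_iInter fun v => isClosed_iInter fun _ =>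
        isClosed_eq (continuous_apply v) continuous_const).inter
        (isClosed_eq (by fun_prop) continuous_const))
  · rintro x ⟨h0, h1, h2⟩ v -
    refine ⟨h0 v, ?_⟩
    by_cases hv : v ∈ Finset.Icc 1 n
    · exact h2 ▸ Finset.single_le_sum (fun w _ => h0 w) hv
    · simp [h1 v hv]

theorem weightings_nonempty {n : ℕ} (hn : 1 ≤ n) : (weightings n).Nonempty := by
  refine ⟨Pi.single 1 1, fun v => ?_, fun v hv => ?_, ?_⟩
  · by_cases h : v = 1
    · subst h; simp
    · simp [h]
  · have h : v ≠ 1 := by rintro rfl; simp at hv; omega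
    simp [h]
  · rw [Finset.sum_pi_single']
    simp [hn]

/-- The Lagrangian of an `r`-graph with at least one vertex is attained. -/
theorem isGreatest_lagrangian {r n : ℕ} (G : RGraph r n) (hn : 1 ≤ n) :
    IsGreatest (G.weight '' weightings n) G.lagrangian := by
  refine ((isCompact_weightings n).image ?_).isGreatest_sSup ((weightings_nonempty hn).image _)
  unfold weight
  fun_prop

end RGraph

/-- The members of `A` are the first `k` members of the family `F` in the colex ordering, where
`s < t` in colex means `max (s ∆ t) ∈ t`. -/
def IsFirstColex (k : ℕ) (F A : Finset (Finset ℕ)) : Prop :=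
  A ⊆ F ∧ A.card = k ∧ ∀ s ∈ A, ∀ t ∈ F, t ∉ A → toColex s < toColex t

/-! Write `l = n + 3`. The assumptions force every nonedge of `G` to contain two of the vertices
`n + 1`, `n + 2`, `n + 3`. Left-compression provides a maximizer `x` which is antitone on `[l]`, say
with weights `p ≥ q ≥ r` on these vertices. Placing `(p + q + r) / 2` on each of `n + 1` and `n + 2`
and replacing the weights of `1, …, n` by their mean `m` gives a weighting of `[l - 1]`. The
averaging gains at least `(1 / 2 - (a + 2 m) / 3) σ²`, where `σ²` is the sum of the squared
deviations from `m` and `a` bounds the weights, and completing a square shows that this absorbs the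
correlation between the weights and the nonedges they lie in. If `λ(G) ≥ λ([l - 1]^(3))`, then
`a = 1 / 3` is admissible: `x v > 0` implies `6 λ(G) ≤ (1 - x v) ^ 2` by the Lagrange multiplier
condition, and `λ([l - 1]^(3)) ≥ 2 / 25` for `l ≥ 6`. The case `n = 3`, where the averaging estimate
fails, is computed directly.
-/

theorem mul_sum_powersetCard_prod {ι R : Type*} [CommRing R] (x : ι → R) (s : Finset ι) (k : ℕ) :
    k * ∑ e ∈ s.powersetCard k, ∏ v ∈ e, x v =
      (-1) ^ (k + 1) * ∑ a ∈ Finset.HasAntidiagonal.antidiagonal k with a.1 < k,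
        (-1) ^ a.1 * (∑ e ∈ s.powersetCard a.1, ∏ v ∈ e, x v) * ∑ v ∈ s, x v ^ a.2 := by
  classical
  have hesymm (k : ℕ) : MvPolynomial.aeval (fun v : s => x v) (MvPolynomial.esymm s R k) =
      ∑ e ∈ s.powersetCard k, ∏ v ∈ e, x v := by
    rw [MvPolynomial.aeval_esymm_eq_multiset_esymm, ← Finset.esymm_map_val]
    congr 1
    exact (Multiset.map_map ..).symm.trans (congrArg _ s.val.attach_map_val)
  have hpsum (k : ℕ) : MvPolynomial.aeval (fun v : s => x v) (MvPolynomial.psum s R k) =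
      ∑ v ∈ s, x v ^ k := by
    simp only [MvPolynomial.psum, map_sum, map_pow, MvPolynomial.aeval_X]
    exact s.sum_coe_sort fun v => x v ^ k
  have h := congrArg (MvPolynomial.aeval fun v : s => x v) (MvPolynomial.mul_esymm_eq_sum s R k)
  simpa only [map_mul, map_sum, map_pow, map_neg, map_one, map_natCast, hesymm, hpsum] using h

theorem two_mul_sum_powersetCard_two_prod {ι R : Type*} [CommRing R] (x : ι → R) (s : Finset ι) :
    2 * ∑ e ∈ s.powersetCard 2, ∏ v ∈ e, x v = (∑ v ∈ s, x v) ^ 2 - ∑ v ∈ s, x v ^ 2 := by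
  have h := mul_sum_powersetCard_prod x s 2
  rw [show {a ∈ Finset.HasAntidiagonal.antidiagonal 2 | a.1 < 2} = {(0, 2), (1, 1)} by decide,
    Finset.sum_pair (by decide)] at h
  simp only [Finset.powersetCard_zero, Finset.powersetCard_one, Finset.sum_map,
    Finset.sum_singleton, Finset.prod_empty, Finset.prod_singleton, Function.Embedding.coeFn_mk,
    pow_one] at h
  push_cast at h
  linear_combination h

theorem six_mul_sum_powersetCard_three_prod {ι R : Type*} [CommRing R] (x : ι → R) (s : Finset ι) :
    6 * ∑ e ∈ s.powersetCard 3, ∏ v ∈ e, x v =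
      (∑ v ∈ s, x v) ^ 3 - 3 * (∑ v ∈ s, x v) * (∑ v ∈ s, x v ^ 2) + 2 * ∑ v ∈ s, x v ^ 3 := by
  have h := mul_sum_powersetCard_prod x s 3
  rw [show {a ∈ Finset.HasAntidiagonal.antidiagonal 3 | a.1 < 3} = {(0, 3), (1, 2), (2, 1)} by
    decide, Finset.sum_insert (by decide), Finset.sum_pair (by decide)] at h
  simp only [Finset.powersetCard_zero, Finset.powersetCard_one, Finset.sum_map,
    Finset.sum_singleton, Finset.prod_empty, Finset.prod_singleton, Function.Embedding.coeFn_mk,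
    pow_one] at h
  push_cast at h
  linear_combination 2 * h + (∑ v ∈ s, x v) * two_mul_sum_powersetCard_two_prod x s

theorem sum_sq_eq_of_sum_eq_card_mul {ι : Type*} {T : Finset ι} {w : ι → ℝ} {m : ℝ}
    (hm : ∑ v ∈ T, w v = T.card * m) :
    ∑ v ∈ T, w v ^ 2 = T.card * m ^ 2 + ∑ v ∈ T, (w v - m) ^ 2 := by
  have hexpand : ∑ v ∈ T, (w v - m) ^ 2 =
      ∑ v ∈ T, w v ^ 2 - 2 * m * ∑ v ∈ T, w v + ∑ v ∈ T, m ^ 2 := by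
    rw [Finset.mul_sum, ← Finset.sum_sub_distrib, ← Finset.sum_add_distrib]
    exact Finset.sum_congr rfl fun v _ => by ring
  rw [hexpand, hm, Finset.sum_const, nsmul_eq_mul]
  ring

theorem sum_cube_le_of_sum_eq_card_mul {ι : Type*} {T : Finset ι} {w : ι → ℝ} {m a : ℝ}
    (hm : ∑ v ∈ T, w v = T.card * m) (hwa : ∀ v ∈ T, w v ≤ a) :
    ∑ v ∈ T, w v ^ 3 ≤ T.card * m ^ 3 + (a + 2 * m) * ∑ v ∈ T, (w v - m) ^ 2 := by
  have hexpand : ∑ v ∈ T, (w v + 2 * m) * (w v - m) ^ 2 =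
      ∑ v ∈ T, w v ^ 3 - 3 * m ^ 2 * ∑ v ∈ T, w v + ∑ v ∈ T, 2 * m ^ 3 := by
    rw [Finset.mul_sum, ← Finset.sum_sub_distrib, ← Finset.sum_add_distrib]
    exact Finset.sum_congr rfl fun v _ => by ring
  have hle : ∑ v ∈ T, (w v + 2 * m) * (w v - m) ^ 2 ≤ (a + 2 * m) * ∑ v ∈ T, (w v - m) ^ 2 := by
    rw [Finset.mul_sum]
    refine Finset.sum_le_sum fun v hv => mul_le_mul_of_nonneg_right ?_ (sq_nonneg _)
    linarith [hwa v hv]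
  rw [hexpand, hm, Finset.sum_const, nsmul_eq_mul] at hle
  linarith

theorem sum_mul_add_const_pos_of_sum_sq_lt {ι : Type*} {T : Finset ι} {w g : ι → ℝ} {m c κ : ℝ}
    (hm : ∑ v ∈ T, w v = T.card * m) (hκ : 0 < κ)
    (hg : ∑ v ∈ T, g v ^ 2 < 2 * (κ * m) * (T.card * c + ∑ v ∈ T, g v)) :
    0 < ∑ v ∈ T, w v * (c + g v) + κ / 2 * ∑ v ∈ T, (w v - m) ^ 2 := by
  have hsq : 0 ≤ ∑ v ∈ T, (κ * (w v - m) + g v) ^ 2 := Finset.sum_nonneg fun v _ => sq_nonneg _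
  have hexpand : ∑ v ∈ T, (κ * (w v - m) + g v) ^ 2 =
      κ ^ 2 * ∑ v ∈ T, (w v - m) ^ 2 + 2 * κ * ∑ v ∈ T, w v * (c + g v) -
        2 * κ * c * ∑ v ∈ T, w v - 2 * (κ * m) * ∑ v ∈ T, g v + ∑ v ∈ T, g v ^ 2 := by
    simp only [Finset.mul_sum, ← Finset.sum_sub_distrib, ← Finset.sum_add_distrib]
    exact Finset.sum_congr rfl fun v _ => by ring
  rw [hexpand, hm] at hsq
  refine pos_of_mul_pos_right (a := 2 * κ) ?_ (by positivity)
  linarith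

namespace RGraph

section Lagrangian

variable {r n : ℕ}

theorem continuous_weight (G : RGraph r n) : Continuous G.weight := by
  unfold weight
  fun_prop

theorem weight_le_lagrangian (G : RGraph r n) {x : ℕ → ℝ} (hx : x ∈ weightings n) :
    G.weight x ≤ G.lagrangian :=
  le_csSup ((isCompact_weightings n).image G.continuous_weight).bddAbove ⟨x, hx, rfl⟩

theorem exists_weight_eq_lagrangian (G : RGraph r n) (hn : 1 ≤ n) :
    ∃ x ∈ weightings n, G.weight x = G.lagrangian :=
  (G.isGreatest_lagrangian hn).1

theorem weight_const_mul (G : RGraph r n) (c : ℝ) (x : ℕ → ℝ) :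
    G.weight (fun v => c * x v) = c ^ r * G.weight x := by
  unfold weight
  rw [Finset.mul_sum]
  refine Finset.sum_congr rfl fun e he => ?_
  rw [Finset.prod_mul_distrib, Finset.prod_const,
    (Finset.mem_powersetCard.1 (G.edges_subset he)).2]

theorem weight_le_lagrangian_mul_sum_pow (G : RGraph r n) {z : ℕ → ℝ} (hz : ∀ v, 0 ≤ z v)
    (hsupp : ∀ v, v ∉ Finset.Icc 1 n → z v = 0) (hpos : 0 < ∑ v ∈ Finset.Icc 1 n, z v) :
    G.weight z ≤ G.lagrangian * (∑ v ∈ Finset.Icc 1 n, z v) ^ r := by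
  set s := ∑ v ∈ Finset.Icc 1 n, z v
  have hmem : (fun v => s⁻¹ * z v) ∈ weightings n := by
    refine ⟨fun v => mul_nonneg (inv_nonneg.2 hpos.le) (hz v), fun v hv => ?_, ?_⟩
    · simp only [hsupp v hv, mul_zero]
    · rw [← Finset.mul_sum, inv_mul_cancel₀ hpos.ne']
  have h := G.weight_le_lagrangian hmem
  rwa [weight_const_mul, inv_pow, inv_mul_le_iff₀ (pow_pos hpos r), mul_comm] at h

theorem weight_add_weight_compl (G : RGraph r n) (x : ℕ → ℝ) :
    G.weight x + G.compl.weight x = (complete r n).weight x := by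
  rw [add_comm]
  exact Finset.sum_sdiff G.edges_subset

end Lagrangian

section Complete

theorem weight_complete_three (n : ℕ) (x : ℕ → ℝ) : (complete 3 n).weight x =
    ((∑ v ∈ Finset.Icc 1 n, x v) ^ 3 - 3 * (∑ v ∈ Finset.Icc 1 n, x v) *
      (∑ v ∈ Finset.Icc 1 n, x v ^ 2) + 2 * ∑ v ∈ Finset.Icc 1 n, x v ^ 3) / 6 := by
  rw [← six_mul_sum_powersetCard_three_prod, mul_div_cancel_left₀ _ (by norm_num)]
  rfl

theorem weightings_mono {m n : ℕ} (hmn : m ≤ n) : weightings m ⊆ weightings n := by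
  rintro x ⟨h0, hsupp, hsum⟩
  have hsub : Finset.Icc 1 m ⊆ Finset.Icc 1 n := Finset.Icc_subset_Icc_right hmn
  exact ⟨h0, fun v hv => hsupp v fun h => hv (hsub h),
    (Finset.sum_subset hsub fun v _ hv => hsupp v hv).symm.trans hsum⟩

theorem lagrangian_complete_mono {m n : ℕ} (r : ℕ) (hm : 1 ≤ m) (hmn : m ≤ n) :
    (complete r m).lagrangian ≤ (complete r n).lagrangian := by
  obtain ⟨x, hx, hmax⟩ := (complete r m).exists_weight_eq_lagrangian hm
  rw [← hmax]
  refine le_trans ?_ ((complete r n).weight_le_lagrangian (weightings_mono hmn hx))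
  exact Finset.sum_le_sum_of_subset_of_nonneg
    (Finset.powersetCard_mono (Finset.Icc_subset_Icc_right hmn))
    fun e _ _ => Finset.prod_nonneg fun v _ => hx.1 v

theorem choose_div_pow_le_lagrangian_complete (r : ℕ) {n : ℕ} (hn : 1 ≤ n) :
    (n.choose r : ℝ) / n ^ r ≤ (complete r n).lagrangian := by
  let x : ℕ → ℝ := (Finset.Icc 1 n).piecewise (fun _ => (n : ℝ)⁻¹) 0
  have hx_eq (v : ℕ) (hv : v ∈ Finset.Icc 1 n) : x v = (n : ℝ)⁻¹ :=
    Finset.piecewise_eq_of_mem _ _ _ hv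
  have hx_zero (v : ℕ) (hv : v ∉ Finset.Icc 1 n) : x v = 0 :=
    Finset.piecewise_eq_of_notMem _ _ _ hv
  have hn0 : (n : ℝ) ≠ 0 := by positivity
  have hx : x ∈ weightings n := by
    refine ⟨fun v => ?_, hx_zero, ?_⟩
    · by_cases hv : v ∈ Finset.Icc 1 n
      · exact (hx_eq v hv).symm ▸ by positivity
      · exact (hx_zero v hv).ge
    · rw [Finset.sum_congr rfl hx_eq, Finset.sum_const, Nat.card_Icc, Nat.add_sub_cancel,
        nsmul_eq_mul, mul_inv_cancel₀ hn0]
  refine le_of_eq_of_le ?_ ((complete r n).weight_le_lagrangian hx)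
  have hprod (e : Finset ℕ) (he : e ∈ (Finset.Icc 1 n).powersetCard r) :
      ∏ v ∈ e, x v = ((n : ℝ) ^ r)⁻¹ := by
    obtain ⟨hsub, hcard⟩ := Finset.mem_powersetCard.1 he
    rw [Finset.prod_congr rfl fun v hv => hx_eq v (hsub hv), Finset.prod_const, hcard, inv_pow]
  simp only [weight, complete]
  rw [Finset.sum_congr rfl hprod, Finset.sum_const, Finset.card_powersetCard, Nat.card_Icc,
    Nat.add_sub_cancel, nsmul_eq_mul, div_eq_mul_inv]

theorem two_div_twentyfive_le_lagrangian_complete {n : ℕ} (hn : 5 ≤ n) :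
    2 / 25 ≤ (complete 3 n).lagrangian := by
  refine le_trans ?_ (lagrangian_complete_mono 3 (by norm_num) hn)
  refine le_of_eq_of_le ?_ (choose_div_pow_le_lagrangian_complete 3 (by norm_num))
  norm_num [Nat.choose]

end Complete

section LinkWeight

variable {r n : ℕ}

/-- The partial derivative `∂λ(G, x) / ∂x_u`, that is, the weight under `x` of the link of the
vertex `u`. -/
def linkWeight (G : RGraph r n) (u : ℕ) (x : ℕ → ℝ) : ℝ :=
  ∑ e ∈ G.edges with u ∈ e, ∏ v ∈ e.erase u, x v

theorem weight_update (G : RGraph r n) (x : ℕ → ℝ) (u : ℕ) (t : ℝ) :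
    G.weight (Function.update x u t) = G.weight x + (t - x u) * G.linkWeight u x := by
  unfold weight linkWeight
  rw [Finset.sum_filter, Finset.mul_sum, ← Finset.sum_add_distrib]
  refine Finset.sum_congr rfl fun e _ => ?_
  split_ifs with hu
  · rw [Finset.prod_update_of_mem hu, Finset.sdiff_singleton_eq_erase,
      ← Finset.mul_prod_erase e x hu]
    ring
  · rw [Finset.prod_update_of_notMem hu, mul_zero, add_zero]

theorem linkWeight_le_sum_powersetCard (G : RGraph (r + 1) n) (u : ℕ) {x : ℕ → ℝ}
    (hx : ∀ v, 0 ≤ x v) :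
    G.linkWeight u x ≤ ∑ f ∈ ((Finset.Icc 1 n).erase u).powersetCard r, ∏ v ∈ f, x v := by
  have hinj : Set.InjOn (fun e : Finset ℕ => e.erase u) ↑{e ∈ G.edges | u ∈ e} :=
    fun e he f hf h => Finset.erase_injOn' u (Finset.mem_filter.1 he).2 (Finset.mem_filter.1 hf).2 h
  rw [linkWeight, ← Finset.sum_image (f := fun f => ∏ v ∈ f, x v) hinj]
  refine Finset.sum_le_sum_of_subset_of_nonneg ?_ fun f _ _ => Finset.prod_nonneg fun v _ => hx v
  rintro _ hf
  obtain ⟨e, he, rfl⟩ := Finset.mem_image.1 hf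
  obtain ⟨he, hu⟩ := Finset.mem_filter.1 he
  obtain ⟨hsub, hcard⟩ := Finset.mem_powersetCard.1 (G.edges_subset he)
  refine Finset.mem_powersetCard.2 ⟨Finset.erase_subset_erase u hsub, ?_⟩
  rw [Finset.card_erase_of_mem hu, hcard, Nat.add_sub_cancel]

theorem linkWeight_le_sq_div_two (G : RGraph 3 n) {x : ℕ → ℝ} (hx : x ∈ weightings n) {u : ℕ}
    (hu : u ∈ Finset.Icc 1 n) : G.linkWeight u x ≤ (1 - x u) ^ 2 / 2 := by
  obtain ⟨h0, -, hsum⟩ := hx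
  have hle := G.linkWeight_le_sum_powersetCard u h0
  have hpairs := two_mul_sum_powersetCard_two_prod x ((Finset.Icc 1 n).erase u)
  rw [← Finset.add_sum_erase _ x hu] at hsum
  rw [← eq_sub_iff_add_eq'.2 hsum]
  linarith [Finset.sum_nonneg fun v (_ : v ∈ (Finset.Icc 1 n).erase u) => sq_nonneg (x v)]

/-- Frankl and Rödl's form of the Lagrange multiplier condition. -/
theorem linkWeight_eq_mul_lagrangian (G : RGraph r n) {x : ℕ → ℝ} (hx : x ∈ weightings n)
    (hmax : G.weight x = G.lagrangian) {u : ℕ} (hu : u ∈ Finset.Icc 1 n) (hxu : 0 < x u) :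
    G.linkWeight u x = r * G.lagrangian := by
  obtain ⟨h0, hsupp, hsum⟩ := hx
  have hxu1 : x u ≤ 1 := hsum ▸ Finset.single_le_sum (fun v _ => h0 v) hu
  have hbound (t : ℝ) (ht : 0 < t) : G.lagrangian + (t - x u) * G.linkWeight u x ≤
      G.lagrangian * (1 + (t - x u)) ^ r := by
    have hsum' : ∑ v ∈ Finset.Icc 1 n, Function.update x u t v = 1 + (t - x u) := by
      rw [Finset.sum_update_of_mem hu, Finset.sdiff_singleton_eq_erase, ← hsum,
        ← Finset.add_sum_erase _ x hu]
      ring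
    rw [← hmax, ← weight_update, hmax, ← hsum']
    refine G.weight_le_lagrangian_mul_sum_pow (fun v => ?_) (fun v hv => ?_) (by linarith)
    · rcases eq_or_ne v u with rfl | hv
      · simpa only [Function.update_self] using ht.le
      · simpa only [Function.update_of_ne hv] using h0 v
    · rw [Function.update_of_ne (ne_of_mem_of_not_mem hu hv).symm, hsupp v hv]
  let g (t : ℝ) : ℝ := G.lagrangian * (1 + (t - x u)) ^ r -
    (G.lagrangian + (t - x u) * G.linkWeight u x)
  have hmin : IsLocalMin g (x u) := by
    filter_upwards [Ioi_mem_nhds hxu] with t ht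
    simpa [g] using hbound t ht
  have hlin : HasDerivAt (fun t => t - x u) 1 (x u) := (hasDerivAt_id _).sub_const _
  have hderiv : HasDerivAt g (r * G.lagrangian - G.linkWeight u x) (x u) := by
    refine ((((hlin.const_add 1).pow r).const_mul G.lagrangian).sub
      ((hlin.mul_const (G.linkWeight u x)).const_add G.lagrangian)).congr_deriv ?_
    simp only [sub_self, add_zero, one_pow]
    ring
  exact (sub_eq_zero.1 (hmin.hasDerivAt_eq_zero hderiv)).symm

theorem six_mul_lagrangian_le (G : RGraph 3 n) {x : ℕ → ℝ} (hx : x ∈ weightings n)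
    (hmax : G.weight x = G.lagrangian) {u : ℕ} (hu : u ∈ Finset.Icc 1 n) (hxu : 0 < x u) :
    6 * G.lagrangian ≤ (1 - x u) ^ 2 := by
  have hlink := G.linkWeight_eq_mul_lagrangian hx hmax hu hxu
  have hle := G.linkWeight_le_sq_div_two hx hu
  push_cast at hlink
  linarith

theorem apply_le_third_of_weight_eq_lagrangian (G : RGraph 3 n) {x : ℕ → ℝ}
    (hx : x ∈ weightings n) (hmax : G.weight x = G.lagrangian) (hlarge : 2 / 27 ≤ G.lagrangian)
    (u : ℕ) : x u ≤ 1 / 3 := by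
  obtain ⟨h0, hsupp, hsum⟩ := hx
  by_contra! hlt
  have hxu : 0 < x u := by linarith
  have hu : u ∈ Finset.Icc 1 n := not_imp_comm.1 (hsupp u) hxu.ne'
  have hxu1 : x u ≤ 1 := hsum ▸ Finset.single_le_sum (fun v _ => h0 v) hu
  have h := G.six_mul_lagrangian_le ⟨h0, hsupp, hsum⟩ hmax hu hxu
  have hsq : (1 - x u) ^ 2 < (2 / 3) ^ 2 :=
    pow_lt_pow_left₀ (by linarith) (by linarith) two_ne_zero
  linarith

end LinkWeight

section LeftCompressed

theorem orderEmbOfFin_le_of_injOn {α : Type*} [LinearOrder α] {r : ℕ} {s t : Finset α}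
    (hs : s.card = r) (ht : t.card = r) {f : α → α} (hinj : Set.InjOn f s)
    (hmaps : ∀ v ∈ s, f v ∈ t) (hle : ∀ v ∈ s, f v ≤ v) (p : Fin r) :
    t.orderEmbOfFin ht p ≤ s.orderEmbOfFin hs p := by
  by_contra! hlt
  have hmem (k : Fin r) : s.orderEmbOfFin hs k ∈ s := Finset.orderEmbOfFin_mem s hs k
  have hcard : (Finset.Iic p).card ≤ ((Finset.Iio p).image (t.orderEmbOfFin ht)).card := by
    refine Finset.card_le_card_of_injOn (fun k => f (s.orderEmbOfFin hs k)) (fun k hk => ?_)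
      fun k _ k' _ h => (s.orderEmbOfFin hs).injective (hinj (hmem k) (hmem k') h)
    have hkt := hmaps _ (hmem k)
    rw [← Finset.mem_coe, ← Finset.range_orderEmbOfFin t ht] at hkt
    obtain ⟨k', hk'⟩ := hkt
    refine Finset.mem_image.2 ⟨k', Finset.mem_Iio.2 ((t.orderEmbOfFin ht).lt_iff_lt.1 ?_), hk'⟩
    calc t.orderEmbOfFin ht k' = f (s.orderEmbOfFin hs k) := hk'
      _ ≤ s.orderEmbOfFin hs k := hle _ (hmem k)
      _ ≤ s.orderEmbOfFin hs p := (s.orderEmbOfFin hs).monotone (Finset.mem_Iic.1 hk)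
      _ < t.orderEmbOfFin ht p := hlt
  have := hcard.trans Finset.card_image_le
  rw [Fin.card_Iic, Fin.card_Iio] at this
  omega

variable {r n : ℕ} {G : RGraph r n}

theorem LeftCompressed.map_swap_mem (hG : G.LeftCompressed) {e : Finset ℕ} (he : e ∈ G.edges)
    {u w : ℕ} (hu : 1 ≤ u) (huw : u < w) (hue : u ∉ e) :
    e.map (Equiv.swap u w).toEmbedding ∈ G.edges := by
  obtain ⟨hsub, hcard⟩ := Finset.mem_powersetCard.1 (G.edges_subset he)
  have hcard' : (e.map (Equiv.swap u w).toEmbedding).card = r := (Finset.card_map _).trans hcard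
  have hswap (v : ℕ) (hv : v ∈ e) : Equiv.swap u w v ≤ v := by
    rcases eq_or_ne v w with rfl | hvw
    · exact (Equiv.swap_apply_right u v).trans_le huw.le
    · exact (Equiv.swap_apply_of_ne_of_ne (ne_of_mem_of_not_mem hv hue) hvw).le
  have hpos (v : ℕ) (hv : v ∈ e.map (Equiv.swap u w).toEmbedding) : 1 ≤ v := by
    obtain ⟨v', hv', rfl⟩ := Finset.mem_map.1 hv
    rcases eq_or_ne v' w with rfl | hvw
    · exact (Equiv.swap_apply_right u v').ge.trans' hu
    · exact (Equiv.swap_apply_of_ne_of_ne (ne_of_mem_of_not_mem hv' hue) hvw).ge.trans'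
        (Finset.mem_Icc.1 (hsub hv')).1
  have h := hG _ _ (Finset.orderEmbOfFin _ hcard').strictMono (e.orderEmbOfFin hcard).strictMono
    (fun p => hpos _ (Finset.orderEmbOfFin_mem _ _ p))
    (orderEmbOfFin_le_of_injOn hcard hcard' (Equiv.injective _).injOn
      (fun v hv => Finset.mem_map_of_mem _ hv) hswap)
  rw [Finset.image_orderEmbOfFin_univ, Finset.image_orderEmbOfFin_univ] at h
  exact h he

theorem map_swap_eq_self {e : Finset ℕ} {u w : ℕ} (h : u ∈ e ↔ w ∈ e) :
    e.map (Equiv.swap u w).toEmbedding = e := by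
  ext v
  rw [Finset.mem_map_equiv, Equiv.symm_swap, Equiv.swap_apply_def]
  split_ifs with hu hw
  · rw [hu, h]
  · rw [hw, h]
  · rfl

theorem LeftCompressed.weight_le_weight_swap (hG : G.LeftCompressed) {x : ℕ → ℝ}
    (hx : ∀ v, 0 ≤ x v) {u w : ℕ} (hu : 1 ≤ u) (huw : u < w) (hxuw : x u ≤ x w) :
    G.weight x ≤ G.weight (x ∘ Equiv.swap u w) := by
  let τ (e : Finset ℕ) : Finset ℕ := e.map (Equiv.swap u w).toEmbedding
  have hτ (e : Finset ℕ) : τ (τ e) = e := by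
    ext v
    simp only [τ, Finset.mem_map_equiv, Equiv.symm_swap, Equiv.swap_apply_self]
  have hprod (e : Finset ℕ) : ∏ v ∈ e, (x ∘ Equiv.swap u w) v = ∏ v ∈ τ e, x v :=
    (Finset.prod_map e (Equiv.swap u w).toEmbedding x).symm
  unfold weight
  rw [← Finset.sum_filter_add_sum_filter_not G.edges (fun e => τ e ∈ G.edges),
    ← Finset.sum_filter_add_sum_filter_not G.edges (fun e => τ e ∈ G.edges)
      fun e => ∏ v ∈ e, (x ∘ Equiv.swap u w) v]
  refine add_le_add (le_of_eq ?_) (Finset.sum_le_sum fun e he => ?_)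
  · refine Finset.sum_nbij' τ τ ?_ ?_ (fun e _ => hτ e) (fun e _ => hτ e)
      fun e _ => by rw [hprod, hτ]
    all_goals
      intro e he
      rw [Finset.mem_filter] at he ⊢
      exact ⟨he.2, (hτ e).symm ▸ he.1⟩
  · obtain ⟨he, hτe⟩ := Finset.mem_filter.1 he
    have hue : u ∈ e := by_contra fun hue => hτe (hG.map_swap_mem he hu huw hue)
    have hwe : w ∉ e := fun hwe => hτe <| by
      simpa only [τ, map_swap_eq_self (iff_of_true hue hwe)] using he
    have hrest : ∏ v ∈ e.erase u, (x ∘ Equiv.swap u w) v = ∏ v ∈ e.erase u, x v :=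
      Finset.prod_congr rfl fun v hv => congrArg x <| Equiv.swap_apply_of_ne_of_ne
        (Finset.ne_of_mem_erase hv) (ne_of_mem_of_not_mem (Finset.mem_of_mem_erase hv) hwe)
    rw [← Finset.mul_prod_erase e x hue, ← Finset.mul_prod_erase e (x ∘ Equiv.swap u w) hue, hrest,
      Function.comp_apply, Equiv.swap_apply_left]
    exact mul_le_mul_of_nonneg_right hxuw (Finset.prod_nonneg fun v _ => hx v)

theorem comp_perm_mem_weightings {x : ℕ → ℝ} (hx : x ∈ weightings n) {σ : Equiv.Perm ℕ}
    (hσ : {v | σ v ≠ v} ⊆ Finset.Icc 1 n) : x ∘ σ ∈ weightings n := by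
  refine ⟨fun v => hx.1 _, fun v hv => ?_, (σ.sum_comp _ x hσ).trans hx.2.2⟩
  rw [Function.comp_apply, not_not.1 fun h => hv (hσ h), hx.2.1 v hv]

theorem LeftCompressed.exists_antitoneOn_maximizer (hG : G.LeftCompressed) (hn : 1 ≤ n) :
    ∃ x ∈ weightings n, G.weight x = G.lagrangian ∧
      AntitoneOn x (Finset.Icc 1 n : Set ℕ) := by
  have hcomp : IsCompact (weightings n ∩ {x | G.weight x = G.lagrangian}) :=
    (isCompact_weightings n).inter_right (isClosed_eq G.continuous_weight continuous_const)
  obtain ⟨x₀, hx₀, hmax₀⟩ := G.exists_weight_eq_lagrangian hn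
  -- a maximizer of least centre of mass cannot have an inversion
  obtain ⟨x, ⟨hx, hmax⟩, hmin⟩ := hcomp.exists_isMinOn ⟨x₀, hx₀, hmax₀⟩
    (f := fun x : ℕ → ℝ => ∑ v ∈ Finset.Icc 1 n, (v : ℝ) * x v) (by fun_prop)
  refine ⟨x, hx, hmax, fun u hu w hw huw => ?_⟩
  by_contra! hlt
  have huw : u < w := huw.lt_of_ne fun h => hlt.ne (congrArg x h)
  have hσ : {v | Equiv.swap u w v ≠ v} ⊆ Finset.Icc 1 n := fun v hv => by
    rcases (Equiv.swap_apply_ne_self_iff.1 hv).2 with rfl | rfl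
    exacts [hu, hw]
  have hy := comp_perm_mem_weightings hx hσ
  have hymax : G.weight (x ∘ Equiv.swap u w) = G.lagrangian :=
    (G.weight_le_lagrangian hy).antisymm <| hmax.ge.trans <|
      hG.weight_le_weight_swap hx.1 (Finset.mem_Icc.1 hu).1 huw hlt.le
  have hle := hmin ⟨hy, hymax⟩
  have hdiff : ∑ v ∈ Finset.Icc 1 n, ((v : ℝ) * x (Equiv.swap u w v) - v * x v) =
      (w - u) * (x u - x w) := by
    rw [Finset.sum_eq_add_of_mem u w hu hw huw.ne fun v _ hv => by
      rw [Equiv.swap_apply_of_ne_of_ne hv.1 hv.2, sub_self],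
      Equiv.swap_apply_left, Equiv.swap_apply_right]
    ring
  rw [Finset.sum_sub_distrib] at hdiff
  have hneg : ((w : ℝ) - u) * (x u - x w) < 0 :=
    mul_neg_of_pos_of_neg (sub_pos.2 (Nat.cast_lt.2 huw)) (sub_neg.2 hlt)
  exact absurd (sub_nonneg.2 hle) (not_le.2 (hdiff.trans_lt hneg))

end LeftCompressed

section LowerLink

variable {n : ℕ}

/-- The vertices below `b` that complete the pair `b < c` to an edge of the `3`-graph `H`. -/
def lowerLink (H : RGraph 3 n) (b c : ℕ) : Finset ℕ :=
  {a ∈ Finset.Ico 1 b | {a, b, c} ∈ H.edges}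

theorem mem_lowerLink {H : RGraph 3 n} {a b c : ℕ} :
    a ∈ H.lowerLink b c ↔ a < b ∧ {a, b, c} ∈ H.edges := by
  rw [lowerLink, Finset.mem_filter, Finset.mem_Ico]
  refine ⟨fun h => ⟨h.1.2, h.2⟩, fun h => ⟨⟨?_, h.1⟩, h.2⟩⟩
  exact (Finset.mem_Icc.1 ((Finset.mem_powersetCard.1 (H.edges_subset h.2)).1
    (Finset.mem_insert_self a _))).1

theorem image_univ_fin_three {α : Type*} [DecidableEq α] (f : Fin 3 → α) :
    Finset.univ.image f = {f 0, f 1, f 2} := by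
  ext
  simp [Fin.exists_fin_succ, eq_comm]

theorem exists_lt_lt_of_card_eq_three {α : Type*} [LinearOrder α] {e : Finset α}
    (he : e.card = 3) : ∃ a b c, a < b ∧ b < c ∧ e = {a, b, c} := by
  have hmono := (e.orderEmbOfFin he).strictMono
  refine ⟨_, _, _, hmono (show (0 : Fin 3) < 1 by decide), hmono (show (1 : Fin 3) < 2 by decide),
    ?_⟩
  exact (Finset.image_orderEmbOfFin_univ e he).symm.trans (image_univ_fin_three _)

theorem sum_edges_eq_sum_lowerLink {M : Type*} [AddCommMonoid M] (H : RGraph 3 n)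
    {P : Finset (ℕ × ℕ)} (hP : ∀ p ∈ P, p.1 < p.2)
    (hH : ∀ a b c, a < b → b < c → {a, b, c} ∈ H.edges → (b, c) ∈ P) (F : Finset ℕ → M) :
    ∑ e ∈ H.edges, F e = ∑ p ∈ P, ∑ a ∈ H.lowerLink p.1 p.2, F {a, p.1, p.2} := by
  rw [Finset.sum_sigma']
  refine (Finset.sum_nbij (fun q : (_ : ℕ × ℕ) × ℕ => {q.2, q.1.1, q.1.2}) ?_ ?_ ?_
    fun _ _ => rfl).symm
  · rintro ⟨⟨b, c⟩, a⟩ hq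
    exact (mem_lowerLink.1 (Finset.mem_sigma.1 hq).2).2
  · rintro ⟨⟨b, c⟩, a⟩ hq ⟨⟨b', c'⟩, a'⟩ hq' h
    obtain ⟨hbc, ha⟩ := Finset.mem_sigma.1 hq
    obtain ⟨hbc', ha'⟩ := Finset.mem_sigma.1 hq'
    have hab := (mem_lowerLink.1 ha).1
    have hab' := (mem_lowerLink.1 ha').1
    have hbc := hP _ hbc
    have hbc' := hP _ hbc'
    have hmem (v : ℕ) := Finset.ext_iff.1 h v
    simp only [Finset.mem_insert, Finset.mem_singleton] at hab hab' hbc hbc' hmem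
    have h1 := hmem a
    have h2 := hmem b
    have h3 := hmem c
    obtain ⟨rfl, rfl, rfl⟩ : a = a' ∧ b = b' ∧ c = c' := by omega
    rfl
  · intro e he
    obtain ⟨a, b, c, hab, hbc, rfl⟩ :=
      exists_lt_lt_of_card_eq_three (Finset.mem_powersetCard.1 (H.edges_subset he)).2
    exact ⟨⟨(b, c), a⟩,
      Finset.mem_sigma.2 ⟨hH a b c hab hbc he, mem_lowerLink.2 ⟨hab, he⟩⟩, rfl⟩

theorem LeftCompressed.triple_mem_compl_edges {G : RGraph 3 n} (hG : G.LeftCompressed)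
    {a b c a' b' c' : ℕ} (hab : a < b) (hbc : b < c) (hab' : a' < b') (hbc' : b' < c')
    (ha : a ≤ a') (hb : b ≤ b') (hc : c ≤ c') (hc' : c' ≤ n)
    (h : {a, b, c} ∈ G.compl.edges) : {a', b', c'} ∈ G.compl.edges := by
  obtain ⟨hmem, hnot⟩ := Finset.mem_sdiff.1 h
  have ha1 : 1 ≤ a :=
    (Finset.mem_Icc.1 ((Finset.mem_powersetCard.1 hmem).1 (Finset.mem_insert_self a _))).1
  have hmono {u v w : ℕ} (huv : u < v) (hvw : v < w) : StrictMono ![u, v, w] := by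
    rw [Fin.strictMono_iff_lt_succ]
    intro p
    fin_cases p
    exacts [huv, hvw]
  refine Finset.mem_sdiff.2 ⟨Finset.mem_powersetCard.2 ⟨?_, ?_⟩, fun h' => hnot ?_⟩
  · simp only [Finset.insert_subset_iff, Finset.singleton_subset_iff, Finset.mem_Icc]
    omega
  · exact Finset.card_eq_three.2 ⟨a', b', c', by omega, by omega, by omega, rfl⟩
  · have hedge := hG ![a, b, c] ![a', b', c'] (hmono hab hbc) (hmono hab' hbc')
      (by intro p; fin_cases p; exacts [ha1, ha1.trans hab.le, ha1.trans (hab.trans hbc).le])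
      (by intro p; fin_cases p; exacts [ha, hb, hc])
    rw [image_univ_fin_three, image_univ_fin_three] at hedge
    exact hedge h'

end LowerLink

section TailNonedges

variable {n : ℕ}

/-- The weight of the nonedges of a `3`-graph on `[n + 3]` whose nonedges are
`{n + 1, n + 2, n + 3}` and the triples `{a, n + 1, n + 2}` with `a ∈ D`, `{a, n + 1, n + 3}` with
`a ∈ I` and `{a, n + 2, n + 3}` with `a ∈ K`. -/
def tailNonedgeWeight (n : ℕ) (D I K : Finset ℕ) (x : ℕ → ℝ) : ℝ :=
  x (n + 1) * x (n + 2) * x (n + 3) + x (n + 1) * x (n + 2) * ∑ v ∈ D, x v +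
    x (n + 1) * x (n + 3) * ∑ v ∈ I, x v + x (n + 2) * x (n + 3) * ∑ v ∈ K, x v

theorem card_compl_edges {G : RGraph 3 (n + 3)}
    (hm : G.edges.card = (n + 2).choose 3 + (n + 1).choose 2) : G.compl.edges.card = n + 1 := by
  have hcard : G.compl.edges.card + G.edges.card = (n + 3).choose 3 := by
    have := Finset.card_sdiff_add_card_eq_card G.edges_subset
    rwa [Finset.card_powersetCard, Nat.card_Icc] at this
  have hpascal₃ : (n + 3).choose 3 = (n + 2).choose 2 + (n + 2).choose 3 :=
    Nat.choose_succ_succ _ _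
  have hpascal₂ : (n + 2).choose 2 = (n + 1).choose 1 + (n + 1).choose 2 :=
    Nat.choose_succ_succ _ _
  rw [Nat.choose_one_right] at hpascal₂
  omega

theorem sum_edges_eq_of_middle_gt {M : Type*} [AddCommMonoid M] (H : RGraph 3 (n + 3))
    (hmid : ∀ a b c, a < b → b < c → {a, b, c} ∈ H.edges → n < b) (F : Finset ℕ → M) :
    ∑ e ∈ H.edges, F e = ∑ a ∈ H.lowerLink (n + 1) (n + 2), F {a, n + 1, n + 2} +
      (∑ a ∈ H.lowerLink (n + 1) (n + 3), F {a, n + 1, n + 3} +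
        ∑ a ∈ H.lowerLink (n + 2) (n + 3), F {a, n + 2, n + 3}) := by
  rw [H.sum_edges_eq_sum_lowerLink (P := {(n + 1, n + 2), (n + 1, n + 3), (n + 2, n + 3)}),
    Finset.sum_insert (by simp), Finset.sum_pair (by simp)]
  · simp
  · intro a b c hab hbc he
    have hb := hmid a b c hab hbc he
    have hc : c ≤ n + 3 := (Finset.mem_Icc.1 ((Finset.mem_powersetCard.1 (H.edges_subset he)).1
      (by simp))).2
    simp only [Finset.mem_insert, Finset.mem_singleton, Prod.mk.injEq]
    omega

theorem lowerLink_subset_Icc {m b c : ℕ} (H : RGraph 3 n) (hb : b ≤ m + 1) :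
    H.lowerLink b c ⊆ Finset.Icc 1 m := fun a ha => by
  have := Finset.mem_Ico.1 (Finset.mem_filter.1 ha).1
  rw [Finset.mem_Icc]
  omega

theorem prod_triple {a b c : ℕ} (hab : a < b) (hbc : b < c) (x : ℕ → ℝ) :
    ∏ v ∈ ({a, b, c} : Finset ℕ), x v = x b * x c * x a := by
  rw [Finset.prod_insert (by simp [hab.ne, (hab.trans hbc).ne]), Finset.prod_pair hbc.ne]
  ring

theorem weight_eq_of_middle_gt (H : RGraph 3 (n + 3))
    (hmid : ∀ a b c, a < b → b < c → {a, b, c} ∈ H.edges → n < b) (x : ℕ → ℝ) :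
    H.weight x = x (n + 1) * x (n + 2) * ∑ v ∈ H.lowerLink (n + 1) (n + 2), x v +
      (x (n + 1) * x (n + 3) * ∑ v ∈ H.lowerLink (n + 1) (n + 3), x v +
        x (n + 2) * x (n + 3) * ∑ v ∈ H.lowerLink (n + 2) (n + 3), x v) := by
  have hprod {b c : ℕ} (hbc : b < c) :
      ∑ a ∈ H.lowerLink b c, ∏ v ∈ ({a, b, c} : Finset ℕ), x v =
        x b * x c * ∑ a ∈ H.lowerLink b c, x a := by
    rw [Finset.mul_sum]
    exact Finset.sum_congr rfl fun a ha => prod_triple (mem_lowerLink.1 ha).1 hbc x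
  rw [weight, H.sum_edges_eq_of_middle_gt hmid, hprod (by omega), hprod (by omega),
    hprod (by omega)]

theorem LeftCompressed.exists_weight_eq_sub_tailNonedgeWeight {G : RGraph 3 (n + 3)}
    (hG : G.LeftCompressed) (hm : G.edges.card = (n + 2).choose 3 + (n + 1).choose 2)
    (hmem : {n, n + 1, n + 2} ∈ G.compl.edges)
    (hmid : ∀ a b c, a < b → b < c → {a, b, c} ∈ G.compl.edges → n < b) :
    ∃ D I K : Finset ℕ, D ⊆ I ∧ I ⊆ K ∧ K ⊆ Finset.Icc 1 n ∧ n ∈ D ∧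
      D.card + I.card + K.card = n ∧
      ∀ x, G.weight x = (complete 3 (n + 3)).weight x - tailNonedgeWeight n D I K x := by
  have hcard := G.compl.sum_edges_eq_of_middle_gt hmid fun _ => 1
  simp only [← Finset.card_eq_sum_ones, card_compl_edges hm] at hcard
  have hweight := G.compl.weight_eq_of_middle_gt hmid
  have hDI : G.compl.lowerLink (n + 1) (n + 2) ⊆ G.compl.lowerLink (n + 1) (n + 3) := fun a ha => by
    obtain ⟨hlt, he⟩ := mem_lowerLink.1 ha
    exact mem_lowerLink.2 ⟨hlt, hG.triple_mem_compl_edges hlt (by omega) hlt (by omega) le_rfl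
      le_rfl (by omega) le_rfl he⟩
  have hIL : G.compl.lowerLink (n + 1) (n + 3) ⊆ G.compl.lowerLink (n + 2) (n + 3) := fun a ha => by
    obtain ⟨hlt, he⟩ := mem_lowerLink.1 ha
    exact mem_lowerLink.2 ⟨by omega, hG.triple_mem_compl_edges hlt (by omega) (by omega) (by omega)
      le_rfl (by omega) le_rfl le_rfl he⟩
  have hnD : n ∈ G.compl.lowerLink (n + 1) (n + 2) := mem_lowerLink.2 ⟨by omega, hmem⟩
  have hnI : n + 1 ∉ G.compl.lowerLink (n + 1) (n + 3) := fun h => (mem_lowerLink.1 h).1.false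
  have hnL : n + 1 ∈ G.compl.lowerLink (n + 2) (n + 3) := mem_lowerLink.2 ⟨by omega,
    hG.triple_mem_compl_edges (by omega) (by omega) (by omega) (by omega) (by omega) (by omega)
      (by omega) le_rfl hmem⟩
  have hL : G.compl.lowerLink (n + 2) (n + 3) ⊆ Finset.Icc 1 (n + 1) :=
    G.compl.lowerLink_subset_Icc le_rfl
  generalize G.compl.lowerLink (n + 1) (n + 2) = D, G.compl.lowerLink (n + 1) (n + 3) = I,
    G.compl.lowerLink (n + 2) (n + 3) = L at *
  refine ⟨D, I, L.erase (n + 1), hDI, Finset.subset_erase.2 ⟨hIL, hnI⟩, fun a ha => ?_, hnD, ?_,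
    fun x => ?_⟩
  · have hne := Finset.ne_of_mem_erase ha
    have hle := Finset.mem_Icc.1 (hL (Finset.mem_of_mem_erase ha))
    exact Finset.mem_Icc.2 (by omega)
  · have := Finset.card_erase_add_one hnL
    omega
  · rw [tailNonedgeWeight, eq_sub_iff_add_eq, ← G.weight_add_weight_compl, hweight,
      ← Finset.add_sum_erase L x hnL]
    ring

end TailNonedges

section Averaging

variable {n : ℕ}

theorem piecewise_const_mem_weightings {x : ℕ → ℝ} (hx : x ∈ weightings n) {T : Finset ℕ}
    (hT : T ⊆ Finset.Icc 1 n) {m : ℝ} (hm : ∑ v ∈ T, x v = T.card * m) :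
    T.piecewise (fun _ => m) x ∈ weightings n := by
  obtain ⟨h0, hsupp, hsum⟩ := hx
  refine ⟨fun v => ?_, fun v hv => ?_, ?_⟩
  · by_cases hv : v ∈ T
    · rw [Finset.piecewise_eq_of_mem _ _ _ hv]
      have hcard : (0 : ℝ) < T.card := by exact_mod_cast Finset.card_pos.2 ⟨v, hv⟩
      exact nonneg_of_mul_nonneg_right (hm ▸ Finset.sum_nonneg fun u _ => h0 u) hcard
    · rw [Finset.piecewise_eq_of_notMem _ _ _ hv]
      exact h0 v
  · rw [Finset.piecewise_eq_of_notMem _ _ _ fun h => hv (hT h)]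
    exact hsupp v hv
  · rw [Finset.sum_piecewise, Finset.inter_eq_right.2 hT, Finset.sum_const, nsmul_eq_mul, ← hm,
      add_comm, Finset.sum_sdiff hT, hsum]

theorem weight_complete_three_add_le_lagrangian {x : ℕ → ℝ} (hx : x ∈ weightings n)
    {T : Finset ℕ} (hT : T ⊆ Finset.Icc 1 n) {m a : ℝ} (hm : ∑ v ∈ T, x v = T.card * m)
    (ha : ∀ v ∈ T, x v ≤ a) :
    (complete 3 n).weight x + (1 / 2 - (a + 2 * m) / 3) * ∑ v ∈ T, (x v - m) ^ 2 ≤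
      (complete 3 n).lagrangian := by
  have hy := piecewise_const_mem_weightings hx hT hm
  have hpow (k : ℕ) : ∑ v ∈ Finset.Icc 1 n, T.piecewise (fun _ => m) x v ^ k =
      T.card * m ^ k + (∑ v ∈ Finset.Icc 1 n, x v ^ k - ∑ v ∈ T, x v ^ k) := by
    have hpow_piecewise : (fun v => T.piecewise (fun _ => m) x v ^ k) =
        T.piecewise (fun _ => m ^ k) fun v => x v ^ k :=
      funext fun v => apply_ite (· ^ k) (v ∈ T) m (x v)
    rw [hpow_piecewise, Finset.sum_piecewise, Finset.inter_eq_right.2 hT, Finset.sum_const,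
      nsmul_eq_mul, ← Finset.sum_sdiff hT, add_sub_cancel_right]
  refine le_trans ?_ ((complete 3 n).weight_le_lagrangian hy)
  rw [weight_complete_three, weight_complete_three, hy.2.2, hx.2.2, hpow, hpow,
    sum_sq_eq_of_sum_eq_card_mul hm]
  linarith [sum_cube_le_of_sum_eq_card_mul hm ha]

theorem weight_complete_three_lt_lagrangian (hn : 5 ≤ n) {x : ℕ → ℝ} (hx : x ∈ weightings n)
    {u : ℕ} (hu : u ∈ Finset.Icc 1 n) (hxu : x u = 0) :
    (complete 3 n).weight x < (complete 3 n).lagrangian := by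
  have hn' : (5 : ℝ) ≤ n := by exact_mod_cast hn
  have hle_one (v : ℕ) (hv : v ∈ Finset.Icc 1 n) : x v ≤ 1 :=
    hx.2.2 ▸ Finset.single_le_sum (fun w _ => hx.1 w) hv
  have hm : ∑ v ∈ Finset.Icc 1 n, x v = (Finset.Icc 1 n).card * (n : ℝ)⁻¹ := by
    rw [hx.2.2, Nat.card_Icc, Nat.add_sub_cancel, mul_inv_cancel₀ (by positivity)]
  have hinv : (n : ℝ)⁻¹ ≤ 5⁻¹ := inv_anti₀ (by norm_num) hn'
  have hdev : 0 < ∑ v ∈ Finset.Icc 1 n, (x v - (n : ℝ)⁻¹) ^ 2 := by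
    refine Finset.sum_pos' (fun v _ => sq_nonneg _) ⟨u, hu, ?_⟩
    rw [hxu, zero_sub, neg_sq]
    positivity
  have h := weight_complete_three_add_le_lagrangian hx subset_rfl hm hle_one
  have := mul_pos (show 0 < 1 / 2 - (1 + 2 * (n : ℝ)⁻¹) / 3 by linarith) hdev
  linarith

end Averaging

section MergeTail

variable {n : ℕ}

/-- The weighting of `[n + 2]` obtained from a weighting `x` of `[n + 3]` by splitting the total
weight of the last three vertices equally between `n + 1` and `n + 2`. -/
noncomputable def mergeTail (n : ℕ) (x : ℕ → ℝ) (v : ℕ) : ℝ :=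
  if v ∈ Finset.Icc 1 n then x v
  else if v ∈ Finset.Icc 1 (n + 2) then (x (n + 1) + x (n + 2) + x (n + 3)) / 2 else 0

theorem mergeTail_of_mem_Icc {v : ℕ} (hv : v ∈ Finset.Icc 1 n) (x : ℕ → ℝ) :
    mergeTail n x v = x v :=
  if_pos hv

theorem sum_Icc_add_three {M : Type*} [AddCommMonoid M] (n : ℕ) (f : ℕ → M) :
    ∑ v ∈ Finset.Icc 1 (n + 3), f v =
      ∑ v ∈ Finset.Icc 1 n, f v + f (n + 1) + f (n + 2) + f (n + 3) := by
  rw [Finset.sum_Icc_succ_top (by omega), Finset.sum_Icc_succ_top (by omega),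
    Finset.sum_Icc_succ_top (by omega)]

theorem sum_mergeTail_pow (n : ℕ) (x : ℕ → ℝ) (k : ℕ) :
    ∑ v ∈ Finset.Icc 1 (n + 2), mergeTail n x v ^ k =
      ∑ v ∈ Finset.Icc 1 n, x v ^ k + 2 * ((x (n + 1) + x (n + 2) + x (n + 3)) / 2) ^ k := by
  have h₁ : mergeTail n x (n + 1) = (x (n + 1) + x (n + 2) + x (n + 3)) / 2 := by simp [mergeTail]
  have h₂ : mergeTail n x (n + 2) = (x (n + 1) + x (n + 2) + x (n + 3)) / 2 := by simp [mergeTail]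
  rw [Finset.sum_Icc_succ_top (by omega), Finset.sum_Icc_succ_top (by omega), h₁, h₂, add_assoc,
    ← two_mul, Finset.sum_congr rfl fun v hv => congrArg (· ^ k) (mergeTail_of_mem_Icc hv x)]

theorem mergeTail_mem_weightings {x : ℕ → ℝ} (hx : x ∈ weightings (n + 3)) :
    mergeTail n x ∈ weightings (n + 2) := by
  obtain ⟨h0, -, hsum⟩ := hx
  refine ⟨fun v => ?_, fun v hv => ?_, ?_⟩
  · unfold mergeTail
    split_ifs
    exacts [h0 v, by linarith [h0 (n + 1), h0 (n + 2), h0 (n + 3)], le_rfl]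
  · have hvn : v ∉ Finset.Icc 1 n := fun h => hv (Finset.Icc_subset_Icc_right (by omega) h)
    rw [mergeTail, if_neg hvn, if_neg hv]
  · have h := sum_mergeTail_pow n x 1
    rw [sum_Icc_add_three] at hsum
    simp only [pow_one] at h
    linarith

theorem weight_complete_mergeTail (n : ℕ) (x : ℕ → ℝ) :
    (complete 3 (n + 2)).weight (mergeTail n x) = (complete 3 (n + 3)).weight x +
      (∑ v ∈ Finset.Icc 1 n, x v) * ((x (n + 1) - x (n + 2) - x (n + 3)) ^ 2 / 4 -
        x (n + 2) * x (n + 3)) - x (n + 1) * x (n + 2) * x (n + 3) := by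
  have h₁ := sum_mergeTail_pow n x 1
  simp only [pow_one] at h₁
  simp only [weight_complete_three, h₁, sum_mergeTail_pow, sum_Icc_add_three]
  ring

/-- With `p ≥ q ≥ r` the weights of `n + 1`, `n + 2` and `n + 3`, the coefficient of `x v` in
`tailNonedgeWeight n D I K x`, less `q * r`, its value at the vertices `v ∈ K \ I`. -/
def nonedgeExcess (D I K : Finset ℕ) (p q r : ℝ) (v : ℕ) : ℝ :=
  (if v ∈ D then p * q else 0) + (if v ∈ I then p * r else 0) + (if v ∈ K then q * r else 0) - q * r

section NonedgeExcess

variable {D I K T : Finset ℕ}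

theorem sum_mul_nonedgeExcess (hDI : D ⊆ I) (hIK : I ⊆ K) (hKT : K ⊆ T) (p q r : ℝ) (w : ℕ → ℝ) :
    ∑ v ∈ T, w v * nonedgeExcess D I K p q r v = p * q * ∑ v ∈ D, w v + p * r * ∑ v ∈ I, w v +
      q * r * ∑ v ∈ K, w v - q * r * ∑ v ∈ T, w v := by
  have hsum {U : Finset ℕ} (hU : U ⊆ T) (c : ℝ) :
      ∑ v ∈ T, w v * (if v ∈ U then c else 0) = c * ∑ v ∈ U, w v := by
    simp only [mul_ite, mul_zero, Finset.sum_ite_mem, Finset.inter_eq_right.2 hU, ← Finset.sum_mul]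
    exact mul_comm _ _
  simp only [nonedgeExcess, mul_sub, mul_add, Finset.sum_sub_distrib, Finset.sum_add_distrib,
    hsum hKT, hsum (hIK.trans hKT), hsum (hDI.trans (hIK.trans hKT)), ← Finset.sum_mul]
  ring

theorem sum_nonedgeExcess (hDI : D ⊆ I) (hIK : I ⊆ K) (hKT : K ⊆ T)
    (hcard : D.card + I.card + K.card = T.card) (p q r : ℝ) :
    ∑ v ∈ T, nonedgeExcess D I K p q r v =
      D.card * (q * (p - r)) + I.card * (r * (p - q)) := by
  have h := sum_mul_nonedgeExcess hDI hIK hKT p q r fun _ => 1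
  simp only [one_mul, Finset.sum_const, nsmul_eq_mul, mul_one] at h
  rw [h, ← hcard]
  push_cast
  ring

theorem sum_nonedgeExcess_sq (hDI : D ⊆ I) (hIK : I ⊆ K) (hKT : K ⊆ T)
    (hcard : D.card + I.card + K.card = T.card) (p q r : ℝ) :
    ∑ v ∈ T, nonedgeExcess D I K p q r v ^ 2 = (I.card + D.card) * (q * r) ^ 2 +
      (I.card - D.card) * (p * r) ^ 2 + D.card * (p * q + p * r) ^ 2 := by
  have hsplit (v : ℕ) : nonedgeExcess D I K p q r v ^ 2 = (q * r) ^ 2 +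
      (if v ∈ D then (p * q + p * r) ^ 2 - (p * r) ^ 2 else 0) +
      (if v ∈ I then (p * r) ^ 2 else 0) - (if v ∈ K then (q * r) ^ 2 else 0) := by
    have hI := @hDI v
    have hK := @hIK v
    unfold nonedgeExcess
    split_ifs <;> first | ring1 | tauto
  have hsum {U : Finset ℕ} (hU : U ⊆ T) (c : ℝ) :
      ∑ v ∈ T, (if v ∈ U then c else 0) = U.card * c := by
    rw [Finset.sum_ite_mem, Finset.inter_eq_right.2 hU, Finset.sum_const, nsmul_eq_mul]
  simp only [hsplit, Finset.sum_sub_distrib, Finset.sum_add_distrib, Finset.sum_const,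
    nsmul_eq_mul, hsum hKT, hsum (hIK.trans hKT), hsum (hDI.trans (hIK.trans hKT)), ← hcard]
  push_cast
  ring

end NonedgeExcess

theorem weight_complete_mergeTail_eq {D I K : Finset ℕ} (hDI : D ⊆ I) (hIK : I ⊆ K)
    (hK : K ⊆ Finset.Icc 1 n) (x : ℕ → ℝ) :
    (complete 3 (n + 2)).weight (mergeTail n x) =
      (complete 3 (n + 3)).weight x - tailNonedgeWeight n D I K x +
        ∑ v ∈ Finset.Icc 1 n, x v * ((x (n + 1) - x (n + 2) - x (n + 3)) ^ 2 / 4 +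
          nonedgeExcess D I K (x (n + 1)) (x (n + 2)) (x (n + 3)) v) := by
  rw [weight_complete_mergeTail, tailNonedgeWeight]
  simp only [mul_add, Finset.sum_add_distrib, sum_mul_nonedgeExcess hDI hIK hK, ← Finset.sum_mul]
  ring

end MergeTail

section TailEstimate

theorem two_mul_sq_mul_sq_add_le {p q r : ℝ} (hr : 0 ≤ r) (hrq : r ≤ q) (hqp : q ≤ p) :
    2 * (q * r) ^ 2 + (p * q + p * r) ^ 2 ≤ 8 / 9 * (p + q + r) ^ 2 *
      ((r ^ 2 + (p - q) ^ 2) / 2 + (p - q - r) ^ 2 / 4 + q * (p - r)) := by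
  obtain ⟨s, hs, rfl⟩ : ∃ s, 0 ≤ s ∧ q = r + s := ⟨q - r, by linarith, by ring⟩
  obtain ⟨v, hv, rfl⟩ : ∃ v, 0 ≤ v ∧ p = r + s + v := ⟨p - (r + s), by linarith, by ring⟩
  rw [← sub_nonneg]
  have h : 0 ≤ (48 * r ^ 2 * v ^ 2 + 57 * r ^ 2 * s ^ 2 + 48 * r ^ 2 * s * v +
      108 * r * s * v ^ 2 + 74 * r * s ^ 3 + 102 * r * s ^ 2 * v + 40 * r * v ^ 3 +
      55 * s ^ 2 * v ^ 2 + 23 * s ^ 4 + 46 * s ^ 3 * v + 32 * s * v ^ 3 + 6 * v ^ 4) / 9 := by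
    positivity
  refine h.trans_eq ?_
  ring

theorem sq_add_sq_add_mul_sub_pos {p q r : ℝ} (hr : 0 ≤ r) (hrq : r ≤ q) (hqp : q ≤ p)
    (hp : 0 < p) : 0 < (r ^ 2 + (p - q) ^ 2) / 2 + (p - q - r) ^ 2 / 4 + q * (p - r) := by
  have hqpr : 0 ≤ q * (p - r) := mul_nonneg (hr.trans hrq) (by linarith)
  by_contra! hle
  obtain rfl : r = 0 := by nlinarith [hqpr]
  obtain rfl : p = q := by nlinarith [hqpr]
  nlinarith

theorem sq_sum_deviation_lt {n i j c p q r : ℝ} (hj : 0 < j) (hji : j ≤ i)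
    (hn : 2 * i + j ≤ n) (hr : 0 ≤ r) (hrq : r ≤ q) (hqp : q ≤ p) (hp : 0 < p)
    (hsum : 4 / 9 * (p + q + r) ^ 2 < c) (hpc : 2 * p ^ 2 ≤ c) :
    (i + j) * (q * r) ^ 2 + (i - j) * (p * r) ^ 2 + j * (p * q + p * r) ^ 2 <
      2 * c * (n * ((p - q - r) ^ 2 / 4) + (j * (q * (p - r)) + i * (r * (p - q)))) := by
  have hq : 0 ≤ q := hr.trans hrq
  have hc : 0 ≤ c := le_trans (by positivity) hpc
  set E := (r ^ 2 + (p - q) ^ 2) / 2 + (p - q - r) ^ 2 / 4 + q * (p - r) with hE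
  have hdiag : 2 * (q * r) ^ 2 + (p * q + p * r) ^ 2 < 2 * c * E := by
    refine (two_mul_sq_mul_sq_add_le hr hrq hqp).trans_lt
      (mul_lt_mul_of_pos_right ?_ (sq_add_sq_add_mul_sub_pos hr hrq hqp hp))
    linarith
  have hoff : (q * r) ^ 2 + (p * r) ^ 2 ≤ c * (r ^ 2 + (p - q) ^ 2) := by
    have hqp2 : q ^ 2 ≤ p ^ 2 := pow_le_pow_left₀ hq hqp 2
    calc (q * r) ^ 2 + (p * r) ^ 2 = (q ^ 2 + p ^ 2) * r ^ 2 := by ring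
      _ ≤ c * r ^ 2 := mul_le_mul_of_nonneg_right (by linarith) (sq_nonneg r)
      _ ≤ c * (r ^ 2 + (p - q) ^ 2) :=
        mul_le_mul_of_nonneg_left (by linarith [sq_nonneg (p - q)]) hc
  have hlarge : 2 * c * ((2 * i + j) * ((p - q - r) ^ 2 / 4)) ≤
      2 * c * (n * ((p - q - r) ^ 2 / 4)) := by
    gcongr
  have hdiag' := mul_lt_mul_of_pos_left hdiag hj
  have hoff' := mul_le_mul_of_nonneg_left hoff (sub_nonneg.2 hji)
  rw [hE] at hdiag'
  linarith

theorem sum_mul_add_nonedgeExcess_pos {D I K T : Finset ℕ} (hDI : D ⊆ I) (hIK : I ⊆ K)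
    (hKT : K ⊆ T) (hD : D.Nonempty) (hcard : D.card + I.card + K.card = T.card) {w : ℕ → ℝ}
    {m κ p q r : ℝ} (hm : ∑ v ∈ T, w v = T.card * m) (hκ : 0 < κ) (hr : 0 ≤ r) (hrq : r ≤ q)
    (hqp : q ≤ p) (hp : 0 < p) (hsum : 4 / 9 * (p + q + r) ^ 2 < κ * m)
    (hpκ : 2 * p ^ 2 ≤ κ * m) :
    0 < ∑ v ∈ T, w v * ((p - q - r) ^ 2 / 4 + nonedgeExcess D I K p q r v) +
      κ / 2 * ∑ v ∈ T, (w v - m) ^ 2 := by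
  have hIK' := Finset.card_le_card hIK
  refine sum_mul_add_const_pos_of_sum_sq_lt hm hκ ?_
  rw [sum_nonedgeExcess_sq hDI hIK hKT hcard, sum_nonedgeExcess hDI hIK hKT hcard]
  refine sq_sum_deviation_lt ?_ ?_ ?_ hr hrq hqp hp hsum hpκ
  · exact_mod_cast hD.card_pos
  · exact_mod_cast Finset.card_le_card hDI
  · norm_cast
    omega

end TailEstimate

section TailBounds

variable {n : ℕ} {D I K : Finset ℕ} {x : ℕ → ℝ}

theorem four_ninths_mul_sq_lt_and_two_mul_sq_le {N m p q r : ℝ} (hN : 4 ≤ N) (hr : 0 ≤ r)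
    (hrq : r ≤ q) (hqp : q ≤ p) (hp : 0 < p) (hpm : p ≤ m) (hsum : N * m + (p + q + r) = 1) :
    4 / 9 * (p + q + r) ^ 2 < (7 / 9 - 4 / 3 * m) * m ∧ 2 * p ^ 2 ≤ (7 / 9 - 4 / 3 * m) * m := by
  have hm : 0 < m := hp.trans_le hpm
  have hNm : 4 * m ≤ N * m := mul_le_mul_of_nonneg_right hN hm.le
  constructor
  · calc 4 / 9 * (p + q + r) ^ 2 = 4 / 9 * (p + q + r) * (p + q + r) := by ring
      _ ≤ 4 / 9 * (p + q + r) * (3 * m) := mul_le_mul_of_nonneg_left (by linarith) (by linarith)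
      _ = 4 / 3 * (p + q + r) * m := by ring
      _ < (7 / 9 - 4 / 3 * m) * m := mul_lt_mul_of_pos_right (by linarith) hm
  · calc 2 * p ^ 2 = 2 * p * p := by ring
      _ ≤ (7 / 9 - 4 / 3 * m) * m := mul_le_mul (by linarith) hpm hp.le (by linarith)

theorem weight_sub_tailNonedgeWeight_lt (hDI : D ⊆ I) (hIK : I ⊆ K) (hK : K ⊆ Finset.Icc 1 n)
    (hD : D.Nonempty) (hcard : D.card + I.card + K.card = n) (hn : 4 ≤ n)
    (hx : x ∈ weightings (n + 3)) (hanti : AntitoneOn x (Finset.Icc 1 (n + 3) : Set ℕ))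
    (hthird : ∀ v, x v ≤ 1 / 3) (hpos : 0 < x (n + 1)) :
    (complete 3 (n + 3)).weight x - tailNonedgeWeight n D I K x <
      (complete 3 (n + 2)).lagrangian := by
  have hle {u v : ℕ} (hu : 1 ≤ u) (huv : u ≤ v) (hv : v ≤ n + 3) : x v ≤ x u :=
    hanti (Finset.mem_Icc.2 ⟨hu, huv.trans hv⟩) (Finset.mem_Icc.2 ⟨hu.trans huv, hv⟩) huv
  have hn' : (4 : ℝ) ≤ n := by exact_mod_cast hn
  have hT : (Finset.Icc 1 n).card = n := by simp
  obtain ⟨m, hm⟩ : ∃ m, ∑ v ∈ Finset.Icc 1 n, x v = (Finset.Icc 1 n).card * m :=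
    ⟨(∑ v ∈ Finset.Icc 1 n, x v) / n, by rw [hT, mul_div_cancel₀ _ (by positivity)]⟩
  have hpm : x (n + 1) ≤ m := by
    have hcard_mul := Finset.card_nsmul_le_sum (Finset.Icc 1 n) x (x (n + 1)) fun v hv => by
      have := Finset.mem_Icc.1 hv
      exact hle this.1 (by omega) (by omega)
    rw [hm, nsmul_eq_mul, hT] at hcard_mul
    exact le_of_mul_le_mul_left hcard_mul (by positivity)
  have hr := hx.1 (n + 3)
  have hrq : x (n + 3) ≤ x (n + 2) := hle (by omega) (by omega) le_rfl
  have hqp : x (n + 2) ≤ x (n + 1) := hle (by omega) (by omega) (by omega)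
  have hsum : n * m + (x (n + 1) + x (n + 2) + x (n + 3)) = 1 := by
    rw [← hx.2.2, sum_Icc_add_three, hm, hT]
    ring
  have hκ : 0 < 7 / 9 - 4 / 3 * m := by nlinarith
  obtain ⟨hσ, hp⟩ := four_ninths_mul_sq_lt_and_two_mul_sq_le hn' hr hrq hqp hpos hpm hsum
  have hx_eq (v : ℕ) (hv : v ∈ Finset.Icc 1 n) : mergeTail n x v = x v := mergeTail_of_mem_Icc hv x
  have haverage := weight_complete_three_add_le_lagrangian (mergeTail_mem_weightings hx)
    (Finset.Icc_subset_Icc_right (by omega)) ((Finset.sum_congr rfl hx_eq).trans hm)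
    fun v hv => (hx_eq v hv).trans_le (hthird v)
  rw [Finset.sum_congr rfl fun v hv => congrArg (fun z => (z - m) ^ 2) (hx_eq v hv),
    weight_complete_mergeTail_eq hDI hIK hK] at haverage
  have hgain := sum_mul_add_nonedgeExcess_pos hDI hIK hK hD (hcard.trans hT.symm) hm
    hκ hr hrq hqp hpos hσ hp
  linarith

theorem weight_complete_three_lt_lagrangian_of_tail_eq_zero (hn : 3 ≤ n)
    (hx : x ∈ weightings (n + 3)) (h₁ : x (n + 1) = 0) (h₂ : x (n + 2) = 0)
    (h₃ : x (n + 3) = 0) : (complete 3 (n + 3)).weight x < (complete 3 (n + 2)).lagrangian := by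
  have hmerge := weight_complete_mergeTail n x
  have hzero : mergeTail n x (n + 1) = 0 := by simp [mergeTail, h₁, h₂, h₃]
  have hlt := weight_complete_three_lt_lagrangian (by omega) (mergeTail_mem_weightings hx)
    (Finset.mem_Icc.2 ⟨by omega, by omega⟩) hzero
  rw [h₁, h₂, h₃] at hmerge
  linarith

theorem mul_add_mul_esymm_lt {a b c d e f : ℝ} (ha : 0 ≤ a) (hb : 0 ≤ b) (hc : 0 ≤ c) (hd : 0 ≤ d)
    (he : 0 ≤ e) (hf : 0 ≤ f) (hsum : a + b + c + d + e + f = 1) :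
    a * b * (c + d + e + f) +
      (a + b) * (c * d + c * e + c * f + d * e + d * f + e * f) < 2 / 25 := by
  obtain ⟨t, ht⟩ : ∃ t, t = c + d + e + f := ⟨_, rfl⟩
  have ht0 : 0 ≤ t := by linarith
  have hab : a + b = 1 - t := by linarith
  have hpair : a * b ≤ (1 - t) ^ 2 / 4 := by
    rw [← hab]
    linarith [sq_nonneg (a - b)]
  have hquad : c * d + c * e + c * f + d * e + d * f + e * f ≤ 3 / 8 * t ^ 2 := by
    rw [ht]
    linarith [sq_nonneg (c - d), sq_nonneg (c - e), sq_nonneg (c - f), sq_nonneg (d - e),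
      sq_nonneg (d - f), sq_nonneg (e - f)]
  have hcubic : 0 ≤ (t - 11 / 20) ^ 2 * (t + 21 / 10) := by positivity
  rw [← ht, hab]
  calc a * b * t + (1 - t) * (c * d + c * e + c * f + d * e + d * f + e * f)
      ≤ (1 - t) ^ 2 / 4 * t + (1 - t) * (3 / 8 * t ^ 2) :=
        add_le_add (mul_le_mul_of_nonneg_right hpair ht0)
          (mul_le_mul_of_nonneg_left hquad (by linarith))
    _ < 2 / 25 := by linarith

theorem weight_sub_tailNonedgeWeight_three_lt (hx : x ∈ weightings 6) :
    (complete 3 6).weight x - tailNonedgeWeight 3 {3} {3} {3} x < 2 / 25 := by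
  obtain ⟨h0, -, hsum⟩ := hx
  have hsum_six (f : ℕ → ℝ) :
      ∑ v ∈ Finset.Icc 1 6, f v = f 1 + f 2 + f 3 + f 4 + f 5 + f 6 := by
    rw [sum_Icc_add_three 3, sum_Icc_add_three 0, Finset.Icc_eq_empty (by norm_num),
      Finset.sum_empty, zero_add]
  rw [hsum_six] at hsum
  refine lt_of_eq_of_lt ?_
    (mul_add_mul_esymm_lt (h0 1) (h0 2) (h0 3) (h0 4) (h0 5) (h0 6) hsum)
  simp only [weight_complete_three, hsum_six, tailNonedgeWeight, Finset.sum_singleton,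
    Nat.reduceAdd]
  ring

end TailBounds

theorem LeftCompressed.lagrangian_lt_lagrangian_complete {n : ℕ} {G : RGraph 3 (n + 3)}
    (hG : G.LeftCompressed) (hm : G.edges.card = (n + 2).choose 3 + (n + 1).choose 2)
    (hmem : {n, n + 1, n + 2} ∈ G.compl.edges)
    (hmid : ∀ a b c, a < b → b < c → {a, b, c} ∈ G.compl.edges → n < b) :
    G.lagrangian < (complete 3 (n + 2)).lagrangian := by
  obtain ⟨D, I, K, hDI, hIK, hK, hnD, hcard, hweight⟩ :=
    hG.exists_weight_eq_sub_tailNonedgeWeight hm hmem hmid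
  obtain ⟨x, hx, hmax, hanti⟩ := hG.exists_antitoneOn_maximizer (by omega)
  have hDpos := Finset.card_pos.2 ⟨n, hnD⟩
  have hDI' := Finset.card_le_card hDI
  have hIK' := Finset.card_le_card hIK
  have hlarge := two_div_twentyfive_le_lagrangian_complete (n := n + 2) (by omega)
  obtain rfl | hn : n = 3 ∨ 4 ≤ n := by omega
  · have hsingleton {U : Finset ℕ} (hU : U.card = 1) (h : 3 ∈ U) : U = {3} := by
      obtain ⟨u, rfl⟩ := Finset.card_eq_one.1 hU
      rw [Finset.mem_singleton.1 h]
    rw [← hmax, hweight, hsingleton (by omega) hnD, hsingleton (by omega) (hDI hnD),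
      hsingleton (by omega) (hIK (hDI hnD))]
    exact (weight_sub_tailNonedgeWeight_three_lt hx).trans_le hlarge
  by_contra! hle
  have hthird := G.apply_le_third_of_weight_eq_lagrangian hx hmax (by linarith)
  refine hle.not_gt ?_
  rcases (hx.1 (n + 1)).eq_or_lt with hzero | hpos
  · have hle_zero {v : ℕ} (hv : n + 1 ≤ v) (hv' : v ≤ n + 3) : x v = 0 :=
      le_antisymm (hzero ▸ hanti (by simp) (by simp; omega) hv) (hx.1 v)
    rw [← hmax, hweight, tailNonedgeWeight, ← hzero, hle_zero (v := n + 2) (by omega) (by omega)]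
    simpa using weight_complete_three_lt_lagrangian_of_tail_eq_zero (by omega) hx hzero.symm
      (hle_zero (by omega) (by omega)) (hle_zero (by omega) le_rfl)
  · rw [← hmax, hweight]
    exact weight_sub_tailNonedgeWeight_lt hDI hIK hK ⟨n, hnD⟩ hcard hn hx hanti hthird hpos

theorem middle_gt_of_isFirstColex {n i j : ℕ} {H : RGraph 3 (n + 3)}
    (hfirst : IsFirstColex (j + 1) H.edges
      ((Finset.Icc (n + 1 - j) n).image (fun a => {a, n + 1, n + 2}) ∪
        {{n + 1 - i, n + 1, n + 3}})) {a b c : ℕ} (hab : a < b)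
    (h : {a, b, c} ∈ H.edges) : n < b := by
  by_contra! hb
  have hc : c ≤ n + 3 :=
    (Finset.mem_Icc.1 ((Finset.mem_powersetCard.1 (H.edges_subset h)).1 (by simp))).2
  have hnot : ({a, b, c} : Finset ℕ) ∉
      (Finset.Icc (n + 1 - j) n).image (fun a => ({a, n + 1, n + 2} : Finset ℕ)) ∪
        {{n + 1 - i, n + 1, n + 3}} := fun hmem => by
    obtain ⟨v, w, hv, hvw, hvmem, hwmem⟩ :
        ∃ v w, n < v ∧ v < w ∧ v ∈ ({a, b, c} : Finset ℕ) ∧ w ∈ ({a, b, c} : Finset ℕ) := by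
      rcases Finset.mem_union.1 hmem with hmem | hmem
      · obtain ⟨u, -, hu⟩ := Finset.mem_image.1 hmem
        exact ⟨n + 1, n + 2, by omega, by omega, hu ▸ by simp, hu ▸ by simp⟩
      · rw [Finset.mem_singleton.1 hmem]
        exact ⟨n + 1, n + 3, by omega, by omega, by simp, by simp⟩
    simp only [Finset.mem_insert, Finset.mem_singleton] at hvmem hwmem
    omega
  have hcolex := (Finset.Colex.toColex_lt_toColex.1
    (hfirst.2.2 _ (Finset.mem_union_right _ (Finset.mem_singleton_self _)) _ h hnot)).2
  simp only [Finset.mem_insert, Finset.mem_singleton] at hcolex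
  have hcn : c = n + 3 := by
    by_contra hne
    obtain ⟨v, hv, -, hle⟩ := hcolex (Or.inr (Or.inr rfl)) (by omega)
    omega
  obtain ⟨v, hv, hvs, hle⟩ := hcolex (Or.inr (Or.inl rfl)) (by omega)
  omega

end RGraph

theorem theorem1p11 (l i j : ℕ) (hj : 1 ≤ j) (hij : j ≤ i) (G : RGraph 3 l)
    (hG : G.LeftCompressed)
    (hm : G.edges.card = (l - 1).choose 3 + (l - 2).choose 2)
    (hfirst : IsFirstColex (j + 1) G.compl.edges
      ((Finset.Icc (l - 2 - j) (l - 3)).image (fun a => {a, l - 2, l - 1}) ∪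
        {{l - 2 - i, l - 2, l}})) :
    G.lagrangian < (RGraph.complete 3 (l - 1)).lagrangian := by
  have hl : 3 ≤ l := by
    have h := (Finset.mem_powersetCard.1 (G.compl.edges_subset
      (hfirst.1 (Finset.mem_union_right _ (Finset.mem_singleton_self _))))).1
      (Finset.mem_insert_self _ _)
    rw [Finset.mem_Icc] at h
    omega
  obtain ⟨n, rfl⟩ := Nat.exists_eq_add_of_le' hl
  have hmem : {n, n + 1, n + 2} ∈ G.compl.edges := hfirst.1 (Finset.mem_union_left _
    (Finset.mem_image.2 ⟨n, Finset.mem_Icc.2 (by omega), rfl⟩))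
  exact hG.lagrangian_lt_lagrangian_complete hm hmem fun a b c hab _ h =>
    RGraph.middle_gt_of_isFirstColex hfirst hab h
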